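/- Let $p \ge q \ge 2$ be integers and let $a, b \in \mathbb{C}$. Regard $$F : \mathbb{C}^2 \to \mathbb{C}, \qquad F(z,w) = z^p + w^q + a\bar z + b\bar w,$$ as a smooth map $\mathbb{R}^4 \to \mathbb{R}^2$. Suppose that $F$ is an excellent map, i.e. for each point $x$ of the source there are smooth local coordinates $(x_1,x_2,x_3,x_4)$ centered at $x$ and smooth local coordinates of the target centered at $F(x)$ in which $F$ has one of the forms 1. $(x_1,x_2,x_3,x_4) \mapsto (x_1, x_2)$ (regular point), 2. $(x_1,x_2,x_3,x_4) \mapsto (x_1, x_2^2+x_3^2+x_4^2)$ (definite fold), 3. $(x_1,x_2,x_3,x_4) \mapsto (x_1, x_2^2+x_3^2-x_4^2)$ (indefinite fold), 4. $(x_1,x_2,x_3,x_4) \mapsto (x_1, x_2^2\pm x_3^2+x_1x_4+x_4^3)$ (cusp). Then the set of cusps of $F$ (the points of $\mathbb{C}^2$ of type 4) is finite, and its number of elements belongs to $[(p+1)(q-1),\,(p-1)(q+1)]$. In particular, if $p = q$, then the number of cusps is exactly $p^2-1$. -/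

import Mathlib

open scoped ContDiff

/-- `φ` is a smooth (`C^∞`) system of local coordinates on the real normed space `E`,
centered at the point `x`: a diffeomorphism from an open neighbourhood of `x` onto an
open subset of `ℝⁿ` sending `x` to the origin. -/
structure IsLocalCoordinates {E : Type*} [NormedAddCommGroup E] [NormedSpace ℝ E] {n : ℕ}
    (φ : OpenPartialHomeomorph E (Fin n → ℝ)) (x : E) : Prop where
  mem_source : x ∈ φ.source
  map_eq_zero : φ x = 0
  contDiffOn : ContDiffOn ℝ ∞ φ φ.source
  contDiffOn_symm : ContDiffOn ℝ ∞ φ.symm φ.target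

/-- In suitable smooth local coordinates centered at `x` and at `f x`, the map `f` is
given by `N : ℝᵐ → ℝⁿ`. -/
def HasLocalForm {E F : Type*} [NormedAddCommGroup E] [NormedSpace ℝ E]
    [NormedAddCommGroup F] [NormedSpace ℝ F] {m n : ℕ}
    (f : E → F) (x : E) (N : (Fin m → ℝ) → (Fin n → ℝ)) : Prop :=
  ∃ (φ : OpenPartialHomeomorph E (Fin m → ℝ)) (ψ : OpenPartialHomeomorph F (Fin n → ℝ)),
    IsLocalCoordinates φ x ∧ IsLocalCoordinates ψ (f x) ∧
    Set.MapsTo f φ.source ψ.source ∧ ∀ y ∈ φ.source, ψ (f y) = N (φ y)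

section SingularityTypes

variable {E F : Type*} [NormedAddCommGroup E] [NormedSpace ℝ E]
  [NormedAddCommGroup F] [NormedSpace ℝ F]

/-- Normal form `(x₁, x₂, x₃, x₄) ↦ (x₁, x₂)`. -/
def IsRegularPoint (f : E → F) (x : E) : Prop :=
  HasLocalForm f x (fun v : Fin 4 → ℝ => ![v 0, v 1])

/-- Normal form `(x₁, x₂, x₃, x₄) ↦ (x₁, x₂² + x₃² + x₄²)`. -/
def IsDefiniteFold (f : E → F) (x : E) : Prop :=
  HasLocalForm f x (fun v : Fin 4 → ℝ => ![v 0, v 1 ^ 2 + v 2 ^ 2 + v 3 ^ 2])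

/-- Normal form `(x₁, x₂, x₃, x₄) ↦ (x₁, x₂² + x₃² - x₄²)`. -/
def IsIndefiniteFold (f : E → F) (x : E) : Prop :=
  HasLocalForm f x (fun v : Fin 4 → ℝ => ![v 0, v 1 ^ 2 + v 2 ^ 2 - v 3 ^ 2])

/-- Normal form `(x₁, x₂, x₃, x₄) ↦ (x₁, x₂² ± x₃² + x₁ x₄ + x₄³)`. -/
def IsCuspPoint (f : E → F) (x : E) : Prop :=
  HasLocalForm f x (fun v : Fin 4 → ℝ =>
    ![v 0, v 1 ^ 2 + v 2 ^ 2 + v 0 * v 3 + v 3 ^ 3]) ∨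
  HasLocalForm f x (fun v : Fin 4 → ℝ =>
    ![v 0, v 1 ^ 2 - v 2 ^ 2 + v 0 * v 3 + v 3 ^ 3])

/-- A smooth map from a real 4-dimensional space to a real 2-dimensional one is excellent
if every point is a regular point, a definite fold, an indefinite fold or a cusp. -/
def IsExcellentMap (f : E → F) : Prop :=
  ContDiff ℝ ∞ f ∧
    ∀ x : E, IsRegularPoint f x ∨ IsDefiniteFold f x ∨ IsIndefiniteFold f x ∨ IsCuspPoint f x

/-- The set of cusps of `f`, in the source. -/
def cuspSet (f : E → F) : Set E := {x | IsCuspPoint f x}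

end SingularityTypes

/-- The map `(z, w) ↦ z^p + w^q + a z̄ + b w̄` from `ℂ²` to `ℂ`. -/
def deformedBrieskorn (p q : ℕ) (a b : ℂ) (x : ℂ × ℂ) : ℂ :=
  x.1 ^ p + x.2 ^ q + a * (starRingEnd ℂ) x.1 + b * (starRingEnd ℂ) x.2

/-! Read off in the normal forms, the cusps of an excellent map are exactly the critical points with
degenerate Hessian, and these are isolated. Put `p = m + 1`, `q = n + 1`. The critical points of `F`
form the orbit of a single one under the curve `u ^ m = v ^ n` in the torus, and this curve is
covered by the circles `x ↦ (x ^ (2 * n), ζ * x ^ (2 * m))`, `ζ ^ n = 1`, each of its points being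
hit `2 * n` times in total. On such a circle degeneracy of the Hessian becomes
`Re (A * x ^ ((m + 2) * n) + B * ζ * x ^ ((n + 2) * m)) = 0`. The left-hand side does not vanish
identically, because cusps are isolated, so its number of zeros is at most twice the higher
frequency, by the degree of the associated polynomial. It is at least twice the lower one: if one
term dominates, count its sign changes; if `|A| = |B|`, the zeros are explicit. -/

open ComplexConjugate Topology

section DegenerateCritical

variable {E E' F F' : Type*} [NormedAddCommGroup E] [NormedSpace ℝ E]
  [NormedAddCommGroup E'] [NormedSpace ℝ E']
  [NormedAddCommGroup F] [NormedSpace ℝ F] [NormedAddCommGroup F'] [NormedSpace ℝ F']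

/-- `x` is a critical point of `f` whose Hessian is degenerate. The Hessian is the symmetric form on
`ker (df)` with values in `coker (df)`; the functional `l` selects a codirection, and `h` spans the
degeneracy. -/
def IsDegenerateCritical (f : E → F) (x : E) : Prop :=
  ∃ l : F →L[ℝ] ℝ, l ≠ 0 ∧ (∀ k, l (fderiv ℝ f x k) = 0) ∧
    ∃ h, h ≠ 0 ∧ fderiv ℝ f x h = 0 ∧
      ∀ k, fderiv ℝ f x k = 0 → l (fderiv ℝ (fderiv ℝ f) x h k) = 0

theorem isDegenerateCritical_congr {f g : E → F} {x : E} (h : f =ᶠ[𝓝 x] g) :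
    IsDegenerateCritical f x ↔ IsDegenerateCritical g x := by
  simp only [IsDegenerateCritical, h.fderiv_eq, h.fderiv.fderiv_eq]

theorem fderiv_fderiv_apply {f : E → F} (hf : ContDiff ℝ 2 f) (x h k : E) :
    fderiv ℝ (fderiv ℝ f) x h k = fderiv ℝ (fun y => fderiv ℝ f y k) x h := by
  have hd : DifferentiableAt ℝ (fderiv ℝ f) x :=
    (hf.fderiv_right (m := 1) (by norm_num)).differentiable one_ne_zero x
  rw [(hd.hasFDerivAt.clm_apply (hasFDerivAt_const k x)).fderiv]
  simp

theorem fderiv_fderiv_comp {f : E' → F} {g : E → E'} {x : E} (hf : ContDiffAt ℝ 2 f (g x))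
    (hg : ContDiffAt ℝ 2 g x) (h k : E) :
    fderiv ℝ (fderiv ℝ (f ∘ g)) x h k =
      fderiv ℝ (fderiv ℝ f) (g x) (fderiv ℝ g x h) (fderiv ℝ g x k) +
        fderiv ℝ f (g x) (fderiv ℝ (fderiv ℝ g) x h k) := by
  have hg1 : DifferentiableAt ℝ g x := hg.differentiableAt two_ne_zero
  have hg2 : DifferentiableAt ℝ (fderiv ℝ g) x :=
    (hg.fderiv_right (m := 1) (by norm_num)).differentiableAt one_ne_zero
  have hf2 : DifferentiableAt ℝ (fderiv ℝ f) (g x) :=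
    (hf.fderiv_right (m := 1) (by norm_num)).differentiableAt one_ne_zero
  have chain : fderiv ℝ (f ∘ g) =ᶠ[𝓝 x] fun y => (fderiv ℝ f (g y)).comp (fderiv ℝ g y) := by
    filter_upwards [hg.eventually (by simp), hg.continuousAt.eventually (hf.eventually (by simp))]
      with y hgy hfy
    exact fderiv_comp y (hfy.differentiableAt two_ne_zero) (hgy.differentiableAt two_ne_zero)
  have hd := (hf2.hasFDerivAt.comp x hg1.hasFDerivAt).clm_comp hg2.hasFDerivAt
  have happly := DFunLike.congr_fun (DFunLike.congr_fun (chain.fderiv_eq.trans hd.fderiv) h) k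
  simpa [add_comm] using happly

theorem isDegenerateCritical_comp_right {f : E' → F} {g : E → E'} {x : E}
    (hf : ContDiffAt ℝ 2 f (g x)) (hg : ContDiffAt ℝ 2 g x)
    (hinv : (fderiv ℝ g x).IsInvertible) :
    IsDegenerateCritical (f ∘ g) x ↔ IsDegenerateCritical f (g x) := by
  obtain ⟨e, he⟩ := hinv
  have hfg : fderiv ℝ (f ∘ g) x = (fderiv ℝ f (g x)).comp (e : E →L[ℝ] E') := by
    rw [he]
    exact fderiv_comp x (hf.differentiableAt two_ne_zero) (hg.differentiableAt two_ne_zero)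
  simp only [IsDegenerateCritical, fderiv_fderiv_comp hf hg, hfg, ← he,
    ContinuousLinearMap.comp_apply, ContinuousLinearEquiv.coe_coe, map_add]
  refine exists_congr fun l => and_congr_right fun _ => ?_
  rw [← e.surjective.forall (p := fun k => l (fderiv ℝ f (g x) k) = 0)]
  refine and_congr_right fun hl => ?_
  rw [e.surjective.exists]
  simp only [hl, add_zero, EmbeddingLike.map_ne_zero_iff, e.surjective.forall]

theorem isDegenerateCritical_comp_left {f : E → F} {g : F → F'} {x : E}
    (hg : ContDiffAt ℝ 2 g (f x)) (hf : ContDiffAt ℝ 2 f x)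
    (hinv : (fderiv ℝ g (f x)).IsInvertible) :
    IsDegenerateCritical (g ∘ f) x ↔ IsDegenerateCritical f x := by
  obtain ⟨e, he⟩ := hinv
  have hgf : fderiv ℝ (g ∘ f) x = (e : F →L[ℝ] F').comp (fderiv ℝ f x) := by
    rw [he]
    exact fderiv_comp x (hg.differentiableAt two_ne_zero) (hf.differentiableAt two_ne_zero)
  have hdual : Function.Surjective fun l : F' →L[ℝ] ℝ => l.comp (e : F →L[ℝ] F') :=
    fun l => ⟨l.comp (e.symm : F' →L[ℝ] F), by ext; simp⟩
  have hdual0 (l : F' →L[ℝ] ℝ) : l.comp (e : F →L[ℝ] F') ≠ 0 ↔ l ≠ 0 := by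
    simp [ContinuousLinearMap.ext_iff, e.surjective.forall]
  simp only [IsDegenerateCritical, fderiv_fderiv_comp hg hf, hgf, ← he,
    ContinuousLinearMap.comp_apply, ContinuousLinearEquiv.coe_coe, map_add,
    EmbeddingLike.map_eq_zero_iff, hdual.exists, hdual0]
  refine exists_congr fun l => and_congr_right fun _ => and_congr_right fun _ =>
    exists_congr fun h => and_congr_right fun _ => and_congr_right fun hh => ?_
  simp [hh]

theorem fderiv_comp_fderiv_of_leftInverse {f : E → E'} {g : E' → E} {x : E}
    (hg : DifferentiableAt ℝ g (f x)) (hf : DifferentiableAt ℝ f x)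
    (h : ∀ᶠ y in 𝓝 x, g (f y) = y) :
    (fderiv ℝ g (f x)).comp (fderiv ℝ f x) = ContinuousLinearMap.id ℝ E := by
  rw [← fderiv_comp x hg hf, Filter.EventuallyEq.fderiv_eq (f₁ := g ∘ f) (f := id) h, fderiv_id]

section LocalCoordinates

variable {n : ℕ} {φ : OpenPartialHomeomorph E (Fin n → ℝ)} {x y : E}

theorem IsLocalCoordinates.contDiffAt (hφ : IsLocalCoordinates φ x) (hy : y ∈ φ.source) :
    ContDiffAt ℝ ∞ φ y :=
  hφ.contDiffOn.contDiffAt (φ.open_source.mem_nhds hy)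

theorem IsLocalCoordinates.isInvertible_fderiv (hφ : IsLocalCoordinates φ x)
    (hy : y ∈ φ.source) : (fderiv ℝ φ y).IsInvertible := by
  have hd : DifferentiableAt ℝ φ y := (hφ.contDiffAt hy).differentiableAt (by simp)
  have hd' : DifferentiableAt ℝ φ.symm (φ y) :=
    (hφ.contDiffOn_symm.contDiffAt
      (φ.open_target.mem_nhds (φ.map_source hy))).differentiableAt (by simp)
  have hleft := fderiv_comp_fderiv_of_leftInverse hd' hd (φ.eventually_left_inverse hy)
  have hright := fderiv_comp_fderiv_of_leftInverse (by rwa [φ.left_inv hy]) hd'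
    (φ.eventually_right_inverse (φ.map_source hy))
  rw [φ.left_inv hy] at hright
  exact .of_inverse hright hleft

end LocalCoordinates

section LocalForm

variable {m n : ℕ} {f : E → F} {x : E} {N : (Fin m → ℝ) → (Fin n → ℝ)}

theorem HasLocalForm.exists_coordinates (h : HasLocalForm f x N) (hf : ContDiff ℝ 2 f)
    (hN : ContDiff ℝ 2 N) :
    ∃ φ : OpenPartialHomeomorph E (Fin m → ℝ), IsLocalCoordinates φ x ∧
      ∀ y ∈ φ.source, (IsDegenerateCritical f y ↔ IsDegenerateCritical N (φ y)) := by
  obtain ⟨φ, ψ, hφ, hψ, hmaps, hfN⟩ := h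
  refine ⟨φ, hφ, fun y hy => ?_⟩
  have hev : ψ ∘ f =ᶠ[𝓝 y] N ∘ φ := by
    filter_upwards [φ.open_source.mem_nhds hy] with z hz using hfN z hz
  rw [← isDegenerateCritical_comp_left ((hψ.contDiffAt (hmaps hy)).of_le ENat.LEInfty.out)
      hf.contDiffAt (hψ.isInvertible_fderiv (hmaps hy)),
    isDegenerateCritical_congr hev,
    isDegenerateCritical_comp_right hN.contDiffAt ((hφ.contDiffAt hy).of_le ENat.LEInfty.out)
      (hφ.isInvertible_fderiv hy)]

theorem HasLocalForm.isDegenerateCritical_iff (h : HasLocalForm f x N) (hf : ContDiff ℝ 2 f)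
    (hN : ContDiff ℝ 2 N) : IsDegenerateCritical f x ↔ IsDegenerateCritical N 0 := by
  obtain ⟨φ, hφ, hdeg⟩ := h.exists_coordinates hf hN
  rw [hdeg x hφ.mem_source, hφ.map_eq_zero]

theorem HasLocalForm.eventually_isDegenerateCritical_imp_eq (h : HasLocalForm f x N)
    (hf : ContDiff ℝ 2 f) (hN : ContDiff ℝ 2 N) (hN0 : ∀ v, IsDegenerateCritical N v → v = 0) :
    ∀ᶠ y in 𝓝 x, IsDegenerateCritical f y → y = x := by
  obtain ⟨φ, hφ, hdeg⟩ := h.exists_coordinates hf hN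
  filter_upwards [φ.open_source.mem_nhds hφ.mem_source] with y hy hfy
  refine φ.injOn hy hφ.mem_source ?_
  rw [hφ.map_eq_zero, hN0 _ ((hdeg y hy).1 hfy)]

theorem HasLocalForm.fderiv_ne_zero (h : HasLocalForm f x N) (hf : DifferentiableAt ℝ f x)
    (hN : DifferentiableAt ℝ N 0) (hN0 : fderiv ℝ N 0 ≠ 0) : fderiv ℝ f x ≠ 0 := by
  obtain ⟨φ, ψ, hφ, hψ, -, hfN⟩ := h
  have hev : ψ ∘ f =ᶠ[𝓝 x] N ∘ φ := by
    filter_upwards [φ.open_source.mem_nhds hφ.mem_source] with z hz using hfN z hz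
  have hφd := (hφ.contDiffAt hφ.mem_source).differentiableAt (by simp)
  have hψd := (hψ.contDiffAt hψ.mem_source).differentiableAt (by simp)
  rw [← hφ.map_eq_zero] at hN hN0
  have hchain := hev.fderiv_eq (𝕜 := ℝ)
  rw [fderiv_comp x hψd hf, fderiv_comp x hN hφd] at hchain
  contrapose! hN0
  ext1 v
  obtain ⟨u, rfl⟩ := (hφ.isInvertible_fderiv hφ.mem_source).bijective.surjective v
  simpa [hN0] using (DFunLike.congr_fun hchain u).symm

end LocalForm

end DegenerateCritical

section Graph

variable {n : ℕ} [NeZero n] {g : (Fin n → ℝ) → ℝ}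

theorem contDiff_graph {r : WithTop ℕ∞} (hg : ContDiff ℝ r g) :
    ContDiff ℝ r (fun v => ![v 0, g v]) :=
  contDiff_pi.2 (Fin.forall_fin_two.2 ⟨contDiff_apply ℝ ℝ 0, hg⟩)

theorem fderiv_graph {v : Fin n → ℝ} (hg : DifferentiableAt ℝ g v) (k : Fin n → ℝ) :
    fderiv ℝ (fun v => ![v 0, g v]) v k = ![k 0, fderiv ℝ g v k] := by
  rw [fderiv_pi (Fin.forall_fin_two.2 ⟨differentiableAt_apply 0 v, hg⟩)]
  ext i
  fin_cases i
  · simp [fderiv_apply]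
  · simp

theorem fderiv_graph_ne_zero {v : Fin n → ℝ} (hg : DifferentiableAt ℝ g v) :
    fderiv ℝ (fun v => ![v 0, g v]) v ≠ 0 := by
  intro h
  have hbasis := fderiv_graph hg (Pi.single 0 1)
  rw [h] at hbasis
  simpa using congrFun hbasis 0

theorem fderiv_fderiv_graph (hg : ContDiff ℝ 2 g) (v h k : Fin n → ℝ) :
    fderiv ℝ (fderiv ℝ (fun v => ![v 0, g v])) v h k = ![0, fderiv ℝ (fderiv ℝ g) v h k] := by
  have hdiff : DifferentiableAt ℝ (fun y => fderiv ℝ g y k) v :=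
    ((hg.fderiv_right (m := 1) (by norm_num)).clm_apply contDiff_const).differentiable
      one_ne_zero v
  rw [fderiv_fderiv_apply (contDiff_graph hg), fderiv_fderiv_apply hg]
  simp only [fderiv_graph (hg.differentiable two_ne_zero _)]
  rw [fderiv_pi (Fin.forall_fin_two.2 ⟨differentiableAt_const (k 0), hdiff⟩)]
  ext i
  fin_cases i <;> simp

theorem dual_apply_zero_vec (l : (Fin 2 → ℝ) →L[ℝ] ℝ) (t : ℝ) :
    l ![0, t] = t * l ![0, 1] := by
  rw [← smul_eq_mul, ← map_smul]
  simp

theorem dual_apply_zero_one_ne_zero {l : (Fin 2 → ℝ) →L[ℝ] ℝ} (hl : l ≠ 0) {s : ℝ}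
    (h : l ![1, s] = 0) : l ![0, 1] ≠ 0 := by
  contrapose! hl
  ext w
  have hw : w = w 0 • ![1, s] + ![0, w 1 - w 0 * s] := by ext i; fin_cases i <;> simp
  rw [hw, map_add, map_smul, h, dual_apply_zero_vec, hl]
  simp

theorem isDegenerateCritical_graph_iff (hg : ContDiff ℝ 2 g) (v : Fin n → ℝ) :
    IsDegenerateCritical (fun v => ![v 0, g v]) v ↔
      (∀ k, k 0 = 0 → fderiv ℝ g v k = 0) ∧
        ∃ h, h ≠ 0 ∧ h 0 = 0 ∧ ∀ k, k 0 = 0 → fderiv ℝ (fderiv ℝ g) v h k = 0 := by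
  have hzero (s t : ℝ) : ![s, t] = 0 ↔ s = 0 ∧ t = 0 := by simp
  simp only [IsDegenerateCritical, fderiv_graph (hg.differentiable two_ne_zero v),
    fderiv_fderiv_graph hg, hzero]
  constructor
  · rintro ⟨l, l_ne, hl, h, h_ne, ⟨hh, -⟩, hdeg⟩
    have hl1 : l ![0, 1] ≠ 0 :=
      dual_apply_zero_one_ne_zero l_ne (by simpa using hl (Pi.single 0 1))
    have hvert (t : ℝ) : l ![0, t] = 0 ↔ t = 0 := by simp [dual_apply_zero_vec l t, hl1]
    have hcrit (k : Fin n → ℝ) (hk : k 0 = 0) : fderiv ℝ g v k = 0 :=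
      (hvert _).1 (hk ▸ hl k)
    exact ⟨hcrit, h, h_ne, hh, fun k hk => (hvert _).1 (hdeg k ⟨hk, hcrit k hk⟩)⟩
  · rintro ⟨hcrit, h, h_ne, hh, hdeg⟩
    have hlin (k : Fin n → ℝ) : fderiv ℝ g v k = k 0 * fderiv ℝ g v (Pi.single 0 1) := by
      have hker := hcrit (k - k 0 • Pi.single 0 1) (by simp)
      rwa [map_sub, map_smul, smul_eq_mul, sub_eq_zero] at hker
    let l : (Fin 2 → ℝ) →L[ℝ] ℝ := ContinuousLinearMap.proj 1 -
      fderiv ℝ g v (Pi.single 0 1) • ContinuousLinearMap.proj 0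
    have hl (s t : ℝ) : l ![s, t] = t - fderiv ℝ g v (Pi.single 0 1) * s := by simp [l]
    refine ⟨l, fun hl0 => ?_, fun k => ?_, h, h_ne, ⟨hh, hcrit h hh⟩, fun k hk => ?_⟩
    · simpa [hl0] using hl 0 1
    · rw [hl, hlin k]; ring
    · rw [hl, hdeg k hk.1]; simp

end Graph

section NormalForms

/-- The second component of the normal forms: folds have `e = 0`, cusps have `d = 0`, `e = 1`. -/
def foldCuspComponent (c d e : ℝ) (v : Fin 4 → ℝ) : ℝ :=
  v 1 ^ 2 + c * v 2 ^ 2 + d * v 3 ^ 2 + e * (v 0 * v 3 + v 3 ^ 3)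

variable (c d e : ℝ)

theorem contDiff_foldCuspComponent {r : WithTop ℕ∞} : ContDiff ℝ r (foldCuspComponent c d e) := by
  unfold foldCuspComponent
  fun_prop

theorem fderiv_foldCuspComponent (v k : Fin 4 → ℝ) :
    fderiv ℝ (foldCuspComponent c d e) v k =
      2 * v 1 * k 1 + 2 * c * v 2 * k 2 + (2 * d * v 3 + e * (v 0 + 3 * v 3 ^ 2)) * k 3 +
        e * v 3 * k 0 := by
  have hv (i : Fin 4) : HasFDerivAt (fun v : Fin 4 → ℝ => v i)
      (ContinuousLinearMap.proj (R := ℝ) (φ := fun _ : Fin 4 => ℝ) i) v := hasFDerivAt_apply i v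
  have hsum := ((((hv 1).pow 2).add (((hv 2).pow 2).const_mul c)).add
    (((hv 3).pow 2).const_mul d)).add ((((hv 0).mul (hv 3)).add ((hv 3).pow 3)).const_mul e)
  refine (DFunLike.congr_fun (HasFDerivAt.fderiv hsum) k).trans ?_
  simp
  ring

theorem fderiv_fderiv_foldCuspComponent (v h k : Fin 4 → ℝ) :
    fderiv ℝ (fderiv ℝ (foldCuspComponent c d e)) v h k =
      2 * h 1 * k 1 + 2 * c * h 2 * k 2 + (2 * d + 6 * e * v 3) * h 3 * k 3 +
        e * (h 0 * k 3 + h 3 * k 0) := by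
  have hv (i : Fin 4) : HasFDerivAt (fun v : Fin 4 → ℝ => v i)
      (ContinuousLinearMap.proj (R := ℝ) (φ := fun _ : Fin 4 => ℝ) i) v := hasFDerivAt_apply i v
  have hsum := (((((hv 1).const_mul 2).mul_const (k 1)).add
    (((hv 2).const_mul (2 * c)).mul_const (k 2))).add
    ((((hv 3).const_mul (2 * d)).add
      (((hv 0).add (((hv 3).pow 2).const_mul 3)).const_mul e)).mul_const (k 3))).add
    (((hv 3).const_mul e).mul_const (k 0))
  rw [fderiv_fderiv_apply (contDiff_foldCuspComponent c d e)]
  simp only [fderiv_foldCuspComponent]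
  refine (DFunLike.congr_fun (HasFDerivAt.fderiv hsum) h).trans ?_
  simp
  ring

theorem isDegenerateCritical_foldCusp_iff (v : Fin 4 → ℝ) :
    IsDegenerateCritical (fun v => ![v 0, foldCuspComponent c d e v]) v ↔
      (v 1 = 0 ∧ c * v 2 = 0 ∧ 2 * d * v 3 + e * (v 0 + 3 * v 3 ^ 2) = 0) ∧
        (c = 0 ∨ 2 * d + 6 * e * v 3 = 0) := by
  rw [isDegenerateCritical_graph_iff (contDiff_foldCuspComponent c d e)]
  simp only [fderiv_foldCuspComponent, fderiv_fderiv_foldCuspComponent]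
  refine and_congr ⟨fun h => ?_, fun ⟨h1, h2, h3⟩ k hk => ?_⟩ ⟨fun ⟨h, h_ne, h0, hdeg⟩ => ?_, ?_⟩
  · exact ⟨by simpa using h (Pi.single 1 1), by simpa using h (Pi.single 2 1),
      by simpa using h (Pi.single 3 1)⟩
  · linear_combination 2 * k 1 * h1 + 2 * k 2 * h2 + k 3 * h3 + e * v 3 * hk
  · have h1 : h 1 = 0 := by simpa using hdeg (Pi.single 1 1)
    have h2 : c = 0 ∨ h 2 = 0 := by simpa using hdeg (Pi.single 2 1)
    have h3 : 2 * d + 6 * e * v 3 = 0 ∨ h 3 = 0 := by simpa [h0] using hdeg (Pi.single 3 1)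
    contrapose! h_ne
    ext i
    fin_cases i
    exacts [h0, h1, h2.resolve_left h_ne.1, h3.resolve_left h_ne.2]
  · rintro (h | h)
    · exact ⟨Pi.single 2 1, by simp, by simp, fun _ _ => by simp [h]⟩
    · exact ⟨Pi.single 3 1, by simp, by simp, fun k hk => by simp [h, hk]⟩

theorem not_isDegenerateCritical_submersion (v : Fin 4 → ℝ) :
    ¬ IsDegenerateCritical (fun v : Fin 4 → ℝ => ![v 0, v 1]) v := by
  rw [isDegenerateCritical_graph_iff (contDiff_apply ℝ ℝ 1)]
  rintro ⟨hcrit, -⟩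
  simpa [fderiv_apply] using hcrit (Pi.single 1 1)

variable {c d}

theorem not_isDegenerateCritical_fold (hc : c ≠ 0) (hd : d ≠ 0) (v : Fin 4 → ℝ) :
    ¬ IsDegenerateCritical (fun v => ![v 0, foldCuspComponent c d 0 v]) v := by
  simp [isDegenerateCritical_foldCusp_iff, hc, hd]

theorem isDegenerateCritical_cusp_iff (hc : c ≠ 0) (v : Fin 4 → ℝ) :
    IsDegenerateCritical (fun v => ![v 0, foldCuspComponent c 0 1 v]) v ↔ v = 0 := by
  rw [isDegenerateCritical_foldCusp_iff]
  refine ⟨fun ⟨⟨h1, h2, h3⟩, h4⟩ => ?_, fun h => by simp [h]⟩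
  have hv3 : v 3 = 0 := by simpa [hc] using h4
  ext i
  fin_cases i
  exacts [by simpa [hv3] using h3, h1, by simpa [hc] using h2, hv3]

end NormalForms

section ExcellentMap

variable {E F : Type*} [NormedAddCommGroup E] [NormedSpace ℝ E]
  [NormedAddCommGroup F] [NormedSpace ℝ F] {f : E → F} {x : E}

theorem IsDefiniteFold.hasLocalForm (h : IsDefiniteFold f x) :
    HasLocalForm f x (fun v => ![v 0, foldCuspComponent 1 1 0 v]) := by
  simpa [foldCuspComponent, IsDefiniteFold] using h

theorem IsIndefiniteFold.hasLocalForm (h : IsIndefiniteFold f x) :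
    HasLocalForm f x (fun v => ![v 0, foldCuspComponent 1 (-1) 0 v]) := by
  simpa [foldCuspComponent, IsIndefiniteFold, sub_eq_add_neg] using h

theorem IsCuspPoint.exists_hasLocalForm (h : IsCuspPoint f x) :
    ∃ c : ℝ, c ≠ 0 ∧ HasLocalForm f x (fun v => ![v 0, foldCuspComponent c 0 1 v]) := by
  rcases h with h | h
  · exact ⟨1, one_ne_zero, by simpa [foldCuspComponent, add_assoc] using h⟩
  · exact ⟨-1, by norm_num, by simpa [foldCuspComponent, sub_eq_add_neg, add_assoc] using h⟩

theorem IsExcellentMap.contDiff_two (hf : IsExcellentMap f) : ContDiff ℝ 2 f :=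
  hf.1.of_le ENat.LEInfty.out

theorem IsExcellentMap.fderiv_ne_zero (hf : IsExcellentMap f) (x : E) : fderiv ℝ f x ≠ 0 := by
  have of_graph {g : (Fin 4 → ℝ) → ℝ} (hg : ContDiff ℝ 1 g)
      (h : HasLocalForm f x (fun v => ![v 0, g v])) : fderiv ℝ f x ≠ 0 :=
    h.fderiv_ne_zero (hf.contDiff_two.differentiable two_ne_zero x)
      ((contDiff_graph hg).differentiable one_ne_zero 0)
      (fderiv_graph_ne_zero (hg.differentiable one_ne_zero 0))
  rcases hf.2 x with h | h | h | h
  · exact of_graph (contDiff_apply ℝ ℝ 1) h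
  · exact of_graph (contDiff_foldCuspComponent ..) h.hasLocalForm
  · exact of_graph (contDiff_foldCuspComponent ..) h.hasLocalForm
  · obtain ⟨c, -, h⟩ := h.exists_hasLocalForm
    exact of_graph (contDiff_foldCuspComponent ..) h

theorem IsExcellentMap.isCuspPoint_iff (hf : IsExcellentMap f) :
    IsCuspPoint f x ↔ IsDegenerateCritical f x := by
  have hfold {c d : ℝ} : ContDiff ℝ 2 fun v => ![v 0, foldCuspComponent c d 0 v] :=
    contDiff_graph (contDiff_foldCuspComponent ..)
  constructor
  · intro h
    obtain ⟨c, hc, h⟩ := h.exists_hasLocalForm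
    rw [h.isDegenerateCritical_iff hf.contDiff_two
      (contDiff_graph (contDiff_foldCuspComponent ..)), isDegenerateCritical_cusp_iff hc]
  · intro hdeg
    rcases hf.2 x with h | h | h | h
    · rw [HasLocalForm.isDegenerateCritical_iff h hf.contDiff_two
        (contDiff_graph (contDiff_apply ℝ ℝ 1))] at hdeg
      exact absurd hdeg (not_isDegenerateCritical_submersion 0)
    · rw [h.hasLocalForm.isDegenerateCritical_iff hf.contDiff_two hfold] at hdeg
      exact absurd hdeg (not_isDegenerateCritical_fold one_ne_zero one_ne_zero 0)
    · rw [h.hasLocalForm.isDegenerateCritical_iff hf.contDiff_two hfold] at hdeg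
      exact absurd hdeg (not_isDegenerateCritical_fold one_ne_zero (by norm_num) 0)
    · exact h

theorem IsExcellentMap.discreteTopology (hf : IsExcellentMap f) :
    DiscreteTopology {x | IsDegenerateCritical f x} := by
  rw [discreteTopology_subtype_iff]
  intro x hx
  obtain ⟨c, hc, h⟩ := (hf.isCuspPoint_iff.2 hx).exists_hasLocalForm
  rw [← Filter.empty_mem_iff_bot, Filter.mem_inf_principal]
  filter_upwards [self_mem_nhdsWithin, nhdsWithin_le_nhds
    (h.eventually_isDegenerateCritical_imp_eq hf.contDiff_two
      (contDiff_graph (contDiff_foldCuspComponent ..))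
      fun v => (isDegenerateCritical_cusp_iff hc v).1)] with y hne heq hdeg
  exact hne (heq hdeg)

theorem IsExcellentMap.apply_eq_apply_of_continuous (hf : IsExcellentMap f) {X : Type*}
    [TopologicalSpace X] [PreconnectedSpace X] {γ : X → E} (hγ : Continuous γ)
    (hdeg : ∀ s, IsDegenerateCritical f (γ s)) (s t : X) : γ s = γ t := by
  have := hf.discreteTopology
  exact congrArg Subtype.val <| PreconnectedSpace.constant ‹_› <|
    hγ.codRestrict (s := {x | IsDegenerateCritical f x}) hdeg

end ExcellentMap

section Derivatives

variable (m n : ℕ) (a b : ℂ)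

theorem contDiff_deformedBrieskorn {r : WithTop ℕ∞} (p q : ℕ) :
    ContDiff ℝ r (deformedBrieskorn p q a b) := by
  have hconj : ContDiff ℝ r (starRingEnd ℂ) := Complex.conjCLE.contDiff
  unfold deformedBrieskorn
  fun_prop

theorem fderiv_deformedBrieskorn (x h : ℂ × ℂ) :
    fderiv ℝ (deformedBrieskorn (m + 1) (n + 1) a b) x h =
      (m + 1) * x.1 ^ m * h.1 + (n + 1) * x.2 ^ n * h.2 + a * conj h.1 + b * conj h.2 := by
  have hz : HasFDerivAt (fun x : ℂ × ℂ => x.1) (ContinuousLinearMap.fst ℝ ℂ ℂ) x := hasFDerivAt_fst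
  have hw : HasFDerivAt (fun x : ℂ × ℂ => x.2) (ContinuousLinearMap.snd ℝ ℂ ℂ) x := hasFDerivAt_snd
  have hz' := (Complex.conjCLE.hasFDerivAt (x := x.1)).comp x hz
  have hw' := (Complex.conjCLE.hasFDerivAt (x := x.2)).comp x hw
  have hsum := (((hz.pow (m + 1)).add (hw.pow (n + 1))).add (hz'.const_mul a)).add (hw'.const_mul b)
  refine (DFunLike.congr_fun (HasFDerivAt.fderiv hsum) h).trans ?_
  simp

theorem fderiv_fderiv_deformedBrieskorn (x h k : ℂ × ℂ) :
    fderiv ℝ (fderiv ℝ (deformedBrieskorn (m + 1) (n + 1) a b)) x h k =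
      (m + 1) * (m * x.1 ^ (m - 1) * h.1) * k.1 + (n + 1) * (n * x.2 ^ (n - 1) * h.2) * k.2 := by
  have hz : HasFDerivAt (fun x : ℂ × ℂ => x.1) (ContinuousLinearMap.fst ℝ ℂ ℂ) x := hasFDerivAt_fst
  have hw : HasFDerivAt (fun x : ℂ × ℂ => x.2) (ContinuousLinearMap.snd ℝ ℂ ℂ) x := hasFDerivAt_snd
  have hsum := ((((((hz.pow m).const_mul (m + 1 : ℂ)).mul_const k.1).add
    (((hw.pow n).const_mul (n + 1 : ℂ)).mul_const k.2)).add_const (a * conj k.1)).add_const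
      (b * conj k.2))
  rw [fderiv_fderiv_apply (contDiff_deformedBrieskorn a b _ _)]
  simp only [fderiv_deformedBrieskorn]
  refine (DFunLike.congr_fun (HasFDerivAt.fderiv hsum) h).trans ?_
  simp
  ring

end Derivatives

section ComplexTarget

theorem real_inner_eq_re_conj_mul (z w : ℂ) : inner ℝ z w = (conj z * w).re := by
  rw [Complex.inner, mul_comm]

theorem exists_circle_dual_eq_zero_iff {l : ℂ →L[ℝ] ℝ} (hl : l ≠ 0) :
    ∃ α : Circle, ∀ z, l z = 0 ↔ (conj (α : ℂ) * z).re = 0 := by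
  obtain ⟨β, rfl⟩ := (InnerProductSpace.toDual ℝ ℂ).surjective l
  have hβ : ‖β‖ ≠ 0 := by simpa using hl
  refine ⟨Circle.exp β.arg, fun z => ?_⟩
  have hpolar : conj β = ((‖β‖ : ℝ) : ℂ) * conj (Circle.exp β.arg : ℂ) := by
    rw [← Complex.conj_ofReal, ← map_mul, Circle.coe_exp, Complex.norm_mul_exp_arg_mul_I]
  rw [InnerProductSpace.toDual_apply_apply, real_inner_eq_re_conj_mul, hpolar, mul_assoc,
    Complex.re_ofReal_mul, mul_eq_zero, or_iff_right hβ]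

theorem isDegenerateCritical_iff_exists_circle {E : Type*} [NormedAddCommGroup E]
    [NormedSpace ℝ E] {f : E → ℂ} {x : E} :
    IsDegenerateCritical f x ↔
      ∃ α : Circle, (∀ k, (conj (α : ℂ) * fderiv ℝ f x k).re = 0) ∧
        ∃ h, h ≠ 0 ∧ fderiv ℝ f x h = 0 ∧
          ∀ k, fderiv ℝ f x k = 0 → (conj (α : ℂ) * fderiv ℝ (fderiv ℝ f) x h k).re = 0 := by
  constructor
  · rintro ⟨l, l_ne, hdeg⟩
    obtain ⟨α, hα⟩ := exists_circle_dual_eq_zero_iff l_ne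
    exact ⟨α, by simpa only [hα] using hdeg⟩
  · rintro ⟨α, hdeg⟩
    refine ⟨innerSL ℝ (α : ℂ), by simp [← norm_ne_zero_iff], ?_⟩
    simpa only [innerSL_apply_apply, real_inner_eq_re_conj_mul] using hdeg

theorem forall_re_mul_eq_zero_iff {c : ℂ} : (∀ z : ℂ, (c * z).re = 0) ↔ c = 0 := by
  refine ⟨fun h => ?_, fun h => by simp [h]⟩
  simpa [Complex.mul_conj] using h (conj c)

theorem forall_im_eq_zero_imp_re_eq_zero_iff {c₁ c₂ d₁ d₂ : ℂ} :
    (∀ h k : ℂ, (c₁ * h + c₂ * k).im = 0 → (d₁ * h + d₂ * k).re = 0) ↔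
      ∃ t : ℝ, d₁ = t * Complex.I * c₁ ∧ d₂ = t * Complex.I * c₂ := by
  constructor
  · intro H
    let pairing (e₁ e₂ : ℂ) : ℂ × ℂ →ₗ[ℝ] ℂ :=
      (LinearMap.mulLeft ℝ e₁).coprod (LinearMap.mulLeft ℝ e₂)
    let L : ℂ × ℂ →ₗ[ℝ] ℝ := Complex.imLm ∘ₗ pairing c₁ c₂
    let K : ℂ × ℂ →ₗ[ℝ] ℝ := Complex.reLm ∘ₗ pairing d₁ d₂
    have hspan : K ∈ Submodule.span ℝ (Set.range fun _ : Unit => L) :=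
      mem_span_of_iInf_ker_le_ker (by rw [iInf_const]; exact fun x hx => H x.1 x.2 hx)
    rw [Set.range_const, Submodule.mem_span_singleton] at hspan
    obtain ⟨s, hs⟩ := hspan
    have hmul (h k : ℂ) : s * (c₁ * h + c₂ * k).im = (d₁ * h + d₂ * k).re :=
      LinearMap.congr_fun hs (h, k)
    refine ⟨-s, Complex.ext ?_ ?_, Complex.ext ?_ ?_⟩
    · simpa using (hmul 1 0).symm
    · simpa [neg_eq_iff_eq_neg] using (hmul Complex.I 0).symm
    · simpa using (hmul 0 1).symm
    · simpa [neg_eq_iff_eq_neg] using (hmul 0 Complex.I).symm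
  · rintro ⟨t, rfl, rfl⟩ h k him
    have hfactor : t * Complex.I * c₁ * h + t * Complex.I * c₂ * k =
        t * (Complex.I * (c₁ * h + c₂ * k)) := by ring
    rw [hfactor, Complex.re_ofReal_mul, Complex.I_mul_re, him]
    simp

end ComplexTarget

section Conormal

variable {m n : ℕ} {a b : ℂ} {α : Circle} {x : ℂ × ℂ}

/-- `α` is a unit normal to the image of the differential at `x` of
`(z, w) ↦ z ^ (m + 1) + w ^ (n + 1) + a z̄ + b w̄`; in particular `x` is a critical point. -/
def IsUnitConormal (m n : ℕ) (a b : ℂ) (α : Circle) (x : ℂ × ℂ) : Prop :=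
  (m + 1) * x.1 ^ m = -((α : ℂ) ^ 2 * conj a) ∧ (n + 1) * x.2 ^ n = -((α : ℂ) ^ 2 * conj b)

theorem circle_mul_conj (α : Circle) : (α : ℂ) * conj (α : ℂ) = 1 := by
  rw [Complex.mul_conj, Circle.normSq_coe, Complex.ofReal_one]

theorem isUnitConormal_iff :
    IsUnitConormal m n a b α x ↔
      ∀ k, (conj (α : ℂ) * fderiv ℝ (deformedBrieskorn (m + 1) (n + 1) a b) x k).re = 0 := by
  have hfactor (A c h : ℂ) : (conj (α : ℂ) * (A * h + c * conj h)).re =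
      (conj (α : ℂ) * (A + (α : ℂ) ^ 2 * conj c) * h).re := by
    have hexpand : conj (α : ℂ) * (A + (α : ℂ) ^ 2 * conj c) * h =
        conj (α : ℂ) * A * h + α * conj c * h := by
      linear_combination α * conj c * h * circle_mul_conj α
    rw [hexpand]
    simp
    ring
  have hsplit (k : ℂ × ℂ) :
      (conj (α : ℂ) * fderiv ℝ (deformedBrieskorn (m + 1) (n + 1) a b) x k).re =
        (conj (α : ℂ) * ((m + 1) * x.1 ^ m + (α : ℂ) ^ 2 * conj a) * k.1).re +
        (conj (α : ℂ) * ((n + 1) * x.2 ^ n + (α : ℂ) ^ 2 * conj b) * k.2).re := by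
    rw [← hfactor, ← hfactor, ← Complex.add_re, fderiv_deformedBrieskorn]
    ring_nf
  have hα : conj (α : ℂ) ≠ 0 := (map_ne_zero _).2 α.coe_ne_zero
  simp only [hsplit, IsUnitConormal, eq_neg_iff_add_eq_zero]
  refine ⟨fun ⟨h1, h2⟩ k => by simp [h1, h2], fun H => ⟨?_, ?_⟩⟩
  · refine (mul_eq_zero.1 (forall_re_mul_eq_zero_iff.1 fun z => ?_)).resolve_left hα
    rw [← H (z, 0), mul_zero, Complex.zero_re, add_zero]
  · refine (mul_eq_zero.1 (forall_re_mul_eq_zero_iff.1 fun w => ?_)).resolve_left hα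
    rw [← H (0, w), mul_zero, Complex.zero_re, zero_add]

theorem IsUnitConormal.fderiv_eq_zero_iff (hα : IsUnitConormal m n a b α x) (h : ℂ × ℂ) :
    fderiv ℝ (deformedBrieskorn (m + 1) (n + 1) a b) x h = 0 ↔
      (α * conj a * h.1 + α * conj b * h.2).im = 0 := by
  set s := α * conj a * h.1 + α * conj b * h.2 with hs
  have hder : fderiv ℝ (deformedBrieskorn (m + 1) (n + 1) a b) x h = α * (conj s - s) := by
    simp only [fderiv_deformedBrieskorn, hα.1, hα.2, hs, map_add, map_mul, Complex.conj_conj]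
    linear_combination -(a * conj h.1 + b * conj h.2) * circle_mul_conj α
  rw [hder, mul_eq_zero, or_iff_right α.coe_ne_zero, sub_eq_zero, Complex.conj_eq_iff_im]

/-- The Hessian condition is a Lagrange multiplier equation, with `t` the multiplier. -/
theorem isDegenerateCritical_deformedBrieskorn_iff :
    IsDegenerateCritical (deformedBrieskorn (m + 1) (n + 1) a b) x ↔
      ∃ α : Circle, IsUnitConormal m n a b α x ∧ ∃ h : ℂ × ℂ, h ≠ 0 ∧
        (α * conj a * h.1 + α * conj b * h.2).im = 0 ∧ ∃ t : ℝ,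
          m * x.1 ^ (m - 1) * h.1 = t * Complex.I * x.1 ^ m ∧
          n * x.2 ^ (n - 1) * h.2 = t * Complex.I * x.2 ^ n := by
  rw [isDegenerateCritical_iff_exists_circle]
  refine exists_congr fun α => ?_
  rw [← isUnitConormal_iff]
  refine and_congr_right fun hα => exists_congr fun h => and_congr_right fun _ => ?_
  rw [hα.fderiv_eq_zero_iff]
  refine and_congr_right fun _ => ?_
  have hadjoint {N : ℕ} {Z c : ℂ} (h : (N + 1) * Z = -((α : ℂ) ^ 2 * conj c)) :
      α * conj c = -(conj (α : ℂ) * ((N + 1) * Z)) := by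
    linear_combination conj (α : ℂ) * h - α * conj c * circle_mul_conj α
  have hcancel (N : ℕ) (P Z : ℂ) (t : ℝ) :
      conj (α : ℂ) * ((N + 1) * P) = (-t : ℝ) * Complex.I * -(conj (α : ℂ) * ((N + 1) * Z)) ↔
        P = t * Complex.I * Z := by
    have hne : conj (α : ℂ) * (N + 1) ≠ 0 :=
      mul_ne_zero ((map_ne_zero _).2 α.coe_ne_zero) N.cast_add_one_ne_zero
    rw [← mul_right_inj' hne (c := t * Complex.I * Z), mul_assoc, Complex.ofReal_neg]
    ring_nf
  have hsplit (P Q h k : ℂ) : conj (α : ℂ) * (P * h + Q * k) =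
      conj (α : ℂ) * P * h + conj (α : ℂ) * Q * k := by ring
  simp only [hα.fderiv_eq_zero_iff, fderiv_fderiv_deformedBrieskorn, Prod.forall, hsplit,
    forall_im_eq_zero_imp_re_eq_zero_iff]
  rw [neg_surjective.exists, hadjoint hα.1, hadjoint hα.2]
  simp only [hcancel]

end Conormal

section DegeneratePoints

variable {m n : ℕ} {a b : ℂ} {α : Circle} {x : ℂ × ℂ}

theorem natCast_mul_pow_pred_mul_eq_iff (hm : m ≠ 0) {z h c : ℂ} (hz : z ≠ 0 ∨ m = 1) :
    m * z ^ (m - 1) * h = c * z ^ m ↔ h = c * z / m := by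
  have hpow : z ^ (m - 1) ≠ 0 := by
    rcases hz with hz | rfl
    · exact pow_ne_zero _ hz
    · simp
  rw [eq_div_iff (Nat.cast_ne_zero.2 hm), ← mul_right_inj' hpow (b := h * m),
    ← mul_left_comm c, mul_comm _ z, ← mul_pow_sub_one hm z, mul_comm h]
  ring_nf

theorem IsUnitConormal.fst_eq_zero_iff (hα : IsUnitConormal m n a b α x) (hm : m ≠ 0) :
    x.1 = 0 ↔ a = 0 := by
  have hm' : (m + 1 : ℂ) ≠ 0 := m.cast_add_one_ne_zero
  rw [← pow_eq_zero_iff hm, ← mul_eq_zero_iff_left hm', hα.1]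
  simp

theorem isUnitConormal_swap : IsUnitConormal n m b a α x.swap ↔ IsUnitConormal m n a b α x :=
  and_comm

theorem IsUnitConormal.snd_eq_zero_iff (hα : IsUnitConormal m n a b α x) (hn : n ≠ 0) :
    x.2 = 0 ↔ b = 0 :=
  (isUnitConormal_swap.2 hα).fst_eq_zero_iff hn

theorem isDegenerateCritical_deformedBrieskorn_swap :
    IsDegenerateCritical (deformedBrieskorn (n + 1) (m + 1) b a) x.swap ↔
      IsDegenerateCritical (deformedBrieskorn (m + 1) (n + 1) a b) x := by
  simp only [isDegenerateCritical_deformedBrieskorn_iff, isUnitConormal_swap]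
  refine exists_congr fun α => and_congr_right fun _ => ?_
  rw [Prod.swap_surjective.exists]
  simp [Prod.ext_iff, and_comm, add_comm]

theorem isDegenerateCritical_iff_exists_re_eq_zero (hm : m ≠ 0) (hn : n ≠ 0)
    (ha : a ≠ 0 ∨ m = 1) (hb : b ≠ 0 ∨ n = 1) (hab : a ≠ 0 ∨ b ≠ 0) :
    IsDegenerateCritical (deformedBrieskorn (m + 1) (n + 1) a b) x ↔
      ∃ α : Circle, IsUnitConormal m n a b α x ∧
        (α * (conj a * x.1 / m + conj b * x.2 / n)).re = 0 := by
  rw [isDegenerateCritical_deformedBrieskorn_iff]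
  refine exists_congr fun α => and_congr_right fun hα => ?_
  have hx1 : x.1 ≠ 0 ∨ m = 1 := ha.imp_left (mt (hα.fst_eq_zero_iff hm).1)
  have hx2 : x.2 ≠ 0 ∨ n = 1 := hb.imp_left (mt (hα.snd_eq_zero_iff hn).1)
  simp only [natCast_mul_pow_pred_mul_eq_iff hm hx1, natCast_mul_pow_pred_mul_eq_iff hn hx2]
  have him (t : ℝ) : (α * conj a * (t * Complex.I * x.1 / m) +
      α * conj b * (t * Complex.I * x.2 / n)).im =
        t * (α * (conj a * x.1 / m + conj b * x.2 / n)).re := by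
    have hfactor : α * conj a * (t * Complex.I * x.1 / m) +
        α * conj b * (t * Complex.I * x.2 / n) =
          t * (Complex.I * (α * (conj a * x.1 / m + conj b * x.2 / n))) := by ring
    rw [hfactor, Complex.im_ofReal_mul, Complex.I_mul_im]
  constructor
  · rintro ⟨h, h_ne, hker, t, h1, h2⟩
    have ht : t ≠ 0 := by
      rintro rfl
      exact h_ne (Prod.ext (by simpa using h1) (by simpa using h2))
    rw [h1, h2, him] at hker
    exact (mul_eq_zero.1 hker).resolve_left ht
  · intro hre
    refine ⟨((1 : ℝ) * Complex.I * x.1 / m, (1 : ℝ) * Complex.I * x.2 / n), ?_,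
      by rw [him, hre, mul_zero], 1, rfl, rfl⟩
    have hx : x.1 ≠ 0 ∨ x.2 ≠ 0 :=
      hab.imp (mt (hα.fst_eq_zero_iff hm).1) (mt (hα.snd_eq_zero_iff hn).1)
    simpa [hm, hn, Prod.ext_iff, ← not_and_or] using hx

end DegeneratePoints

section CircleRoots

theorem exists_circle_pow_eq {n : ℕ} (hn : n ≠ 0) (x : Circle) : ∃ y : Circle, y ^ n = x := by
  obtain ⟨t, rfl⟩ := Circle.exp_surjective x
  refine ⟨Circle.exp (t / n), ?_⟩
  rw [← Circle.exp_natCast_mul, mul_div_cancel₀ _ (Nat.cast_ne_zero.2 hn)]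

theorem pow_eq_circle_mul_pow_iff {m : ℕ} (hm : m ≠ 0) {z z₀ : ℂ} (hz₀ : z₀ ≠ 0 ∨ m = 1)
    (c : Circle) : z ^ m = c * z₀ ^ m ↔ ∃ u : Circle, u ^ m = c ∧ z₀ * u = z := by
  constructor
  · intro h
    by_cases hz : z₀ = 0
    · obtain rfl : m = 1 := hz₀.resolve_left (not_not.2 hz)
      exact ⟨c, pow_one c, by simpa [hz, eq_comm] using h⟩
    · have hpow : (z / z₀) ^ m = c := by
        rw [div_pow, h, mul_div_cancel_right₀ _ (pow_ne_zero m hz)]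
      have hnorm : ‖z / z₀‖ = 1 :=
        (pow_eq_one_iff_of_nonneg (norm_nonneg _) hm).1 (by rw [← norm_pow, hpow, Circle.norm_coe])
      refine ⟨⟨z / z₀, mem_sphere_zero_iff_norm.2 hnorm⟩, Circle.ext ?_, mul_div_cancel₀ _ hz⟩
      exact hpow
  · rintro ⟨u, rfl, rfl⟩
    rw [mul_pow, Circle.coe_pow, mul_comm]

end CircleRoots

section Parametrisation

variable {m n : ℕ} {a b : ℂ} {α : Circle} {x x₀ : ℂ × ℂ}

theorem exists_isUnitConormal_one (hm : m ≠ 0) (hn : n ≠ 0) (a b : ℂ) :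
    ∃ x₀, IsUnitConormal m n a b 1 x₀ := by
  obtain ⟨z, hz⟩ := IsAlgClosed.exists_pow_nat_eq (-conj a / (m + 1)) (Nat.pos_of_ne_zero hm)
  obtain ⟨w, hw⟩ := IsAlgClosed.exists_pow_nat_eq (-conj b / (n + 1)) (Nat.pos_of_ne_zero hn)
  refine ⟨(z, w), ?_, ?_⟩
  · simp [hz, mul_div_cancel₀ _ (m.cast_add_one_ne_zero (R := ℂ))]
  · simp [hw, mul_div_cancel₀ _ (n.cast_add_one_ne_zero (R := ℂ))]

theorem IsUnitConormal.iff_pow_eq (h₀ : IsUnitConormal m n a b 1 x₀) :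
    IsUnitConormal m n a b α x ↔
      x.1 ^ m = (α ^ 2 : Circle) * x₀.1 ^ m ∧ x.2 ^ n = (α ^ 2 : Circle) * x₀.2 ^ n := by
  have hscale {N : ℕ} {Z Z₀ c : ℂ} (h : (N + 1) * Z₀ = -((1 : Circle) ^ 2 * conj c)) :
      (N + 1) * Z = -((α : ℂ) ^ 2 * conj c) ↔ Z = (α ^ 2 : Circle) * Z₀ := by
    have hne : (N + 1 : ℂ) ≠ 0 := N.cast_add_one_ne_zero
    have hc : -((α : ℂ) ^ 2 * conj c) = (N + 1) * (((α ^ 2 : Circle) : ℂ) * Z₀) := by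
      rw [mul_left_comm, h]
      simp
    rw [hc, mul_right_inj' hne]
  exact and_congr (hscale h₀.1) (hscale h₀.2)

theorem IsUnitConormal.iff_exists_circle (h₀ : IsUnitConormal m n a b 1 x₀) (hm : m ≠ 0)
    (hn : n ≠ 0) (hz₀ : x₀.1 ≠ 0 ∨ m = 1) (hw₀ : x₀.2 ≠ 0 ∨ n = 1) :
    IsUnitConormal m n a b α x ↔
      ∃ y : Circle × Circle, y.1 ^ m = α ^ 2 ∧ y.2 ^ n = α ^ 2 ∧ (x₀.1 * y.1, x₀.2 * y.2) = x := by
  rw [h₀.iff_pow_eq, pow_eq_circle_mul_pow_iff hm hz₀, pow_eq_circle_mul_pow_iff hn hw₀]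
  constructor
  · rintro ⟨⟨u, hu, hx1⟩, ⟨v, hv, hx2⟩⟩
    exact ⟨(u, v), hu, hv, Prod.ext hx1 hx2⟩
  · rintro ⟨y, hu, hv, rfl⟩
    exact ⟨⟨y.1, hu, rfl⟩, ⟨y.2, hv, rfl⟩⟩

end Parametrisation

section ExcellentParameters

variable {m n : ℕ} {a b : ℂ}

theorem IsExcellentMap.ne_zero_or_ne_zero (hm : m ≠ 0) (hn : n ≠ 0)
    (hf : IsExcellentMap (deformedBrieskorn (m + 1) (n + 1) a b)) : a ≠ 0 ∨ b ≠ 0 := by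
  by_contra! h
  exact hf.fderiv_ne_zero 0 (ContinuousLinearMap.ext fun k => by
    simp [fderiv_deformedBrieskorn, h.1, h.2, hm, hn])

theorem isDegenerateCritical_of_fst_eq_zero {α : Circle} {w : ℂ} (hm : 1 < m)
    (hα : IsUnitConormal m n 0 b α (0, w)) :
    IsDegenerateCritical (deformedBrieskorn (m + 1) (n + 1) 0 b) (0, w) :=
  isDegenerateCritical_deformedBrieskorn_iff.2 ⟨α, hα, (1, 0), by simp, by simp, 0,
    by simp [Nat.sub_ne_zero_of_lt hm], by simp⟩

theorem exists_curve_isDegenerateCritical (hm : 1 < m) (hn : n ≠ 0) (hb : b ≠ 0) :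
    ∃ γ : Circle → ℂ × ℂ, Continuous γ ∧ γ 1 ≠ γ (-1) ∧
      ∀ v, IsDegenerateCritical (deformedBrieskorn (m + 1) (n + 1) 0 b) (γ v) := by
  have hm₀ : m ≠ 0 := (zero_lt_one.trans hm).ne'
  obtain ⟨x₀, hx₀⟩ := exists_isUnitConormal_one hm₀ hn 0 b
  have hz₀ : x₀.1 = 0 := (hx₀.fst_eq_zero_iff hm₀).2 rfl
  have hw₀ : x₀.2 ≠ 0 := mt (hx₀.snd_eq_zero_iff hn).1 hb
  refine ⟨fun v => (0, x₀.2 * v), by fun_prop, by simpa [self_eq_neg] using hw₀, fun v => ?_⟩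
  obtain ⟨α, hα⟩ := exists_circle_pow_eq two_ne_zero (v ^ n)
  refine isDegenerateCritical_of_fst_eq_zero hm ((hx₀.iff_pow_eq (α := α)).2 ⟨?_, ?_⟩)
  · simp [hz₀, hm₀]
  · rw [hα, Circle.coe_pow, mul_pow, mul_comm]

theorem IsExcellentMap.ne_zero_or_eq_one_left (hm : m ≠ 0) (hn : n ≠ 0)
    (hf : IsExcellentMap (deformedBrieskorn (m + 1) (n + 1) a b)) : a ≠ 0 ∨ m = 1 := by
  by_contra! h
  obtain ⟨rfl, hm1⟩ := h
  have hb : b ≠ 0 := (hf.ne_zero_or_ne_zero hm hn).resolve_left (not_not.2 rfl)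
  obtain ⟨γ, hγ, hne, hdeg⟩ := exists_curve_isDegenerateCritical (m := m) (by omega) hn hb
  exact hne (hf.apply_eq_apply_of_continuous hγ hdeg 1 (-1))

theorem IsExcellentMap.ne_zero_or_eq_one_right (hm : m ≠ 0) (hn : n ≠ 0)
    (hf : IsExcellentMap (deformedBrieskorn (m + 1) (n + 1) a b)) : b ≠ 0 ∨ n = 1 := by
  by_contra! h
  obtain ⟨rfl, hn1⟩ := h
  have ha : a ≠ 0 := (hf.ne_zero_or_ne_zero hm hn).resolve_right (not_not.2 rfl)
  obtain ⟨γ, hγ, hne, hdeg⟩ := exists_curve_isDegenerateCritical (m := n) (by omega) hm ha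
  refine hne (Prod.swap_injective ?_)
  exact hf.apply_eq_apply_of_continuous (continuous_swap.comp hγ)
    (fun v => isDegenerateCritical_deformedBrieskorn_swap.1 (by simpa using hdeg v)) 1 (-1)

end ExcellentParameters

section TrigZeros

open Polynomial

/-- The points of the unit circle at which the trigonometric polynomial `Re P(x)` vanishes. -/
def reZeros (P : ℂ[X]) : Set Circle := {x | (P.eval (x : ℂ)).re = 0}

/-- `X ^ d * (P + P̄)` as a genuine polynomial: on the circle `x̄ = x⁻¹`, so that `x ^ d * P̄(x̄)`
is the reversal of the conjugated polynomial. -/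
noncomputable def reflectionSum (P : ℂ[X]) : ℂ[X] :=
  X ^ P.natDegree * P + (P.map (starRingEnd ℂ)).reverse

theorem natDegree_reflectionSum_le (P : ℂ[X]) : (reflectionSum P).natDegree ≤ 2 * P.natDegree := by
  refine natDegree_add_le_of_degree_le ?_ ?_
  · exact natDegree_mul_le.trans (by rw [natDegree_X_pow, two_mul])
  · exact (reverse_natDegree_le _).trans (natDegree_map_le.trans (by omega))

theorem eval_reverse_map_conj (P : ℂ[X]) (x : Circle) :
    (P.map (starRingEnd ℂ)).reverse.eval (x : ℂ) = x ^ P.natDegree * conj (P.eval (x : ℂ)) := by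
  have hinv := circle_mul_conj x
  let : Invertible (conj (x : ℂ)) := ⟨x, hinv, by rw [mul_comm, hinv]⟩
  have hrev : (P.map (starRingEnd ℂ)).reverse.eval (x : ℂ) * conj (x : ℂ) ^ P.natDegree =
      conj (P.eval (x : ℂ)) := by
    rw [← eval_map_apply, ← natDegree_map (starRingEnd ℂ)]
    exact eval₂_reverse_mul_pow (RingHom.id ℂ) (conj (x : ℂ)) (P.map (starRingEnd ℂ))
  rw [← hrev, mul_left_comm, ← mul_pow, hinv, one_pow, mul_one]

theorem eval_reflectionSum (P : ℂ[X]) (x : Circle) :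
    (reflectionSum P).eval (x : ℂ) = x ^ P.natDegree * ((2 * (P.eval (x : ℂ)).re : ℝ) : ℂ) := by
  rw [reflectionSum, eval_add, eval_mul, eval_pow, eval_X, eval_reverse_map_conj, ← mul_add,
    Complex.add_conj]

theorem mem_reZeros_iff_isRoot {P : ℂ[X]} {x : Circle} :
    x ∈ reZeros P ↔ (reflectionSum P).IsRoot x := by
  rw [IsRoot, eval_reflectionSum, mul_eq_zero, or_iff_right (pow_ne_zero _ x.coe_ne_zero)]
  simp [reZeros]

theorem encard_reZeros_le {P : ℂ[X]} (hP : reZeros P ≠ Set.univ) :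
    (reZeros P).encard ≤ (2 * P.natDegree : ℕ) := by
  have hQ : reflectionSum P ≠ 0 := by
    contrapose! hP
    exact Set.eq_univ_of_forall fun x => mem_reZeros_iff_isRoot.2 (by simp [hP])
  calc (reZeros P).encard
      ≤ ((reflectionSum P).roots.toFinset : Set ℂ).encard :=
        Set.encard_le_encard_of_injOn (f := ((↑) : Circle → ℂ))
          (fun x hx => by simpa [hQ] using mem_reZeros_iff_isRoot.1 hx)
          Circle.coe_injective.injOn
    _ = (reflectionSum P).roots.toFinset.card := Set.encard_coe_eq_coe_finsetCard _
    _ ≤ (2 * P.natDegree : ℕ) := by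
      exact_mod_cast (Multiset.toFinset_card_le _).trans
        ((card_roots' _).trans (natDegree_reflectionSum_le P))

theorem exists_strictMono_forall_eq_zero {f : ℝ → ℝ} (hf : Continuous f) {θ : ℕ → ℝ}
    (hθ : StrictMono θ) (halt : ∀ j, 0 < (-1) ^ j * f (θ j)) :
    ∃ t : ℕ → ℝ, StrictMono t ∧ ∀ j, t j ∈ Set.Ioo (θ j) (θ (j + 1)) ∧ f (t j) = 0 := by
  have hzero (j : ℕ) : ∃ t ∈ Set.Ioo (θ j) (θ (j + 1)), (-1) ^ j * f t = 0 := by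
    have hsucc := halt (j + 1)
    rw [pow_succ, mul_neg_one, neg_mul, neg_pos] at hsucc
    exact intermediate_value_Ioo' (hθ j.lt_succ_self).le (by fun_prop) ⟨hsucc, halt j⟩
  choose t ht h0 using hzero
  exact ⟨t, strictMono_nat_of_lt_succ fun j => (ht j).2.trans (ht (j + 1)).1,
    fun j => ⟨ht j, by simpa using h0 j⟩⟩

theorem le_encard_reZeros_of_strictMono {P : ℂ[X]} {t : ℕ → ℝ} {N : ℕ} (ht : StrictMono t)
    (hN : ∀ j < N, t j < t 0 + 2 * Real.pi) (h0 : ∀ j, Circle.exp (t j) ∈ reZeros P) :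
    (N : ℕ∞) ≤ (reZeros P).encard := by
  have hmaps : Set.MapsTo t (Set.Iio N) (Set.Ico (t 0) (t 0 + 2 * Real.pi)) :=
    fun j hj => ⟨ht.monotone j.zero_le, hN j hj⟩
  calc (N : ℕ∞) = (Set.Iio N).encard := by
        rw [← Finset.coe_Iio, Set.encard_coe_eq_coe_finsetCard, Nat.card_Iio]
    _ ≤ (reZeros P).encard := Set.encard_le_encard_of_injOn (fun j _ => h0 j)
        ((Circle.exp_injOn_Ico (add_sub_cancel_left _ _).le).comp ht.injective.injOn hmaps)

theorem re_mul_exp_pow (A : ℂ) (t : ℝ) (m : ℕ) :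
    (A * Circle.exp t ^ m).re = ‖A‖ * Real.cos (m * t + A.arg) := by
  conv_lhs => rw [← Complex.norm_mul_exp_arg_mul_I A]
  rw [mul_assoc, ← Circle.coe_exp, ← Circle.coe_pow, ← Circle.exp_natCast_mul, ← Circle.coe_mul,
    ← Circle.exp_add, Complex.re_ofReal_mul, Circle.coe_exp, Complex.exp_ofReal_mul_I_re, add_comm]

theorem exp_mem_reZeros_iff {A B : ℂ} {m n : ℕ} {t : ℝ} :
    Circle.exp t ∈ reZeros (C A * X ^ m + C B * X ^ n) ↔
      ‖A‖ * Real.cos (m * t + A.arg) + ‖B‖ * Real.cos (n * t + B.arg) = 0 := by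
  rw [← re_mul_exp_pow, ← re_mul_exp_pow, ← Complex.add_re]
  simp [reZeros]

theorem two_mul_le_encard_reZeros_of_norm_lt {A B : ℂ} {m : ℕ} (n : ℕ) (hm : m ≠ 0)
    (hAB : ‖B‖ < ‖A‖) :
    (2 * m : ℕ) ≤ (reZeros (C A * X ^ m + C B * X ^ n)).encard := by
  have : (0 : ℝ) < m := Nat.cast_pos.2 (Nat.pos_of_ne_zero hm)
  let θ (j : ℕ) : ℝ := (j * Real.pi - A.arg) / m
  have hθ : StrictMono θ := fun i j hij => by
    have := Real.pi_pos
    dsimp only [θ]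
    gcongr
  have hθ_period : θ (2 * m) = θ 0 + 2 * Real.pi := by
    simp only [θ]
    push_cast
    field_simp
    ring
  have hdominant (j : ℕ) (s : ℝ) :
      0 < (-1) ^ j * (‖A‖ * Real.cos (m * θ j + A.arg) + ‖B‖ * Real.cos s) := by
    have hphase : m * θ j + A.arg = j * Real.pi := by
      simp only [θ]
      field_simp
      ring
    have hsmall : |(-1) ^ j * (‖B‖ * Real.cos s)| < ‖A‖ := by
      rw [abs_mul, abs_neg_one_pow, one_mul, abs_mul, abs_norm]
      exact (mul_le_of_le_one_right (norm_nonneg _) (Real.abs_cos_le_one s)).trans_lt hAB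
    have hsign : (-1 : ℝ) ^ j * (-1) ^ j = 1 := by rw [← mul_pow]; simp
    rw [hphase, Real.cos_nat_mul_pi]
    linear_combination (abs_lt.1 hsmall).1 - ‖A‖ * hsign
  obtain ⟨t, ht, ht_zero⟩ := exists_strictMono_forall_eq_zero
    (f := fun t => ‖A‖ * Real.cos (m * t + A.arg) + ‖B‖ * Real.cos (n * t + B.arg))
    (by fun_prop) hθ fun j => hdominant j _
  refine le_encard_reZeros_of_strictMono ht (fun j hj => ?_)
    fun j => exp_mem_reZeros_iff.2 (ht_zero j).2
  calc t j < θ (j + 1) := (ht_zero j).1.2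
    _ ≤ θ (2 * m) := hθ.monotone hj
    _ = θ 0 + 2 * Real.pi := hθ_period
    _ < t 0 + 2 * Real.pi := by gcongr; exact (ht_zero 0).1.1

theorem add_le_encard_reZeros_of_norm_eq {A B : ℂ} {m n : ℕ} (hmn : m + n ≠ 0)
    (hAB : ‖A‖ = ‖B‖) : (m + n : ℕ) ≤ (reZeros (C A * X ^ m + C B * X ^ n)).encard := by
  have hpos : (0 : ℝ) < m + n := by exact_mod_cast Nat.pos_of_ne_zero hmn
  let θ (j : ℕ) : ℝ := (Real.pi + 2 * Real.pi * j - A.arg - B.arg) / (m + n)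
  have hθ : StrictMono θ := fun i j hij => by
    have := Real.pi_pos
    dsimp only [θ]
    gcongr
  have hθ_period : θ (m + n) = θ 0 + 2 * Real.pi := by
    simp only [θ]
    push_cast
    field_simp
    ring
  refine le_encard_reZeros_of_strictMono hθ (fun j hj => hθ_period ▸ hθ hj)
    fun j => exp_mem_reZeros_iff.2 ?_
  have hphase : (m * θ j + A.arg + (n * θ j + B.arg)) / 2 = Real.pi / 2 + j * Real.pi := by
    simp only [θ]
    field_simp
    ring
  rw [hAB, ← mul_add, Real.cos_add_cos, hphase, Real.cos_add_nat_mul_pi, Real.cos_pi_div_two]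
  simp

theorem two_mul_le_encard_reZeros {A B : ℂ} {m n : ℕ} (hm : m ≠ 0) (hmn : m ≤ n) :
    (2 * m : ℕ) ≤ (reZeros (C A * X ^ m + C B * X ^ n)).encard := by
  rcases lt_trichotomy ‖A‖ ‖B‖ with h | h | h
  · rw [add_comm]
    exact le_trans (by gcongr) (two_mul_le_encard_reZeros_of_norm_lt m (by omega : n ≠ 0) h)
  · exact le_trans (by gcongr; omega) <|
      add_le_encard_reZeros_of_norm_eq (n := n) (by omega) h
  · exact two_mul_le_encard_reZeros_of_norm_lt n hm h

end TrigZeros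

section Covering

theorem natCard_circle_pow_eq {k : ℕ} (hk : k ≠ 0) (c : Circle) :
    Nat.card {x : Circle // x ^ k = c} = k := by
  have : NeZero k := ⟨hk⟩
  obtain ⟨y, rfl⟩ := exists_circle_pow_eq hk c
  have torsor : {x : Circle // x ^ k = y ^ k} ≃ rootsOfUnity k Circle :=
    ((Equiv.divRight y).trans toUnits.toEquiv).subtypeEquiv fun x => by
      simp [mem_rootsOfUnity, ← map_pow, div_pow, div_eq_one]
  rw [Nat.card_congr torsor, Nat.card_congr (rootsOfUnityCircleEquiv k).toEquiv,
    Complex.card_rootsOfUnity]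

theorem natCard_sigma_mem_Icc {ι : Type*} [Finite ι] {S : ι → Set Circle} {lo hi : ℕ}
    (hlo : ∀ i, lo ≤ (S i).encard) (hhi : ∀ i, (S i).encard ≤ hi) :
    Nat.card (Σ i, S i) ∈ Set.Icc (Nat.card ι * lo) (Nat.card ι * hi) := by
  have := Fintype.ofFinite ι
  have hfin (i : ι) : (S i).Finite := Set.finite_of_encard_le_coe (hhi i)
  have (i : ι) : Finite (S i) := hfin i
  have hcard (i : ι) : Nat.card (S i) ∈ Set.Icc lo hi := by
    rw [Nat.card_coe_set_eq, Set.mem_Icc, ← Nat.cast_le (α := ℕ∞), ← Nat.cast_le (α := ℕ∞),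
      (hfin i).cast_ncard_eq]
    exact ⟨hlo i, hhi i⟩
  rw [Nat.card_sigma, Nat.card_eq_fintype_card (α := ι), ← smul_eq_mul, ← smul_eq_mul]
  exact ⟨Finset.card_nsmul_le_sum _ _ _ fun i _ => (hcard i).1,
    Finset.sum_le_card_nsmul _ _ _ fun i _ => (hcard i).2⟩

variable {m n k l : ℕ}

/-- When `k * m = l * n`, the curve `u ^ m = v ^ n` in the torus is the union over `ζ ^ n = 1` of
the circles `x ↦ (x ^ k, ζ * x ^ l)`; this is the trace of a subset of the torus on one of them. -/
def torusSlice (k l : ℕ) (K : Set (Circle × Circle)) (ζ : Circle) : Set Circle :=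
  {x | (x ^ k, ζ * x ^ l) ∈ K}

/-- The incidence correspondence between the circles covering a subset of `u ^ m = v ^ n` and its
points. -/
noncomputable def sigmaTorusSliceEquiv (hkl : k * m = l * n) {K : Set (Circle × Circle)}
    (hK : ∀ y ∈ K, y.1 ^ m = y.2 ^ n) :
    (Σ ζ : {ζ : Circle // ζ ^ n = 1}, torusSlice k l K ζ) ≃
      Σ y : K, {x : Circle // x ^ k = y.1.1} where
  toFun s := ⟨⟨(s.2 ^ k, s.1 * s.2 ^ l), s.2.2⟩, s.2, rfl⟩
  invFun t := ⟨⟨t.1.1.2 / t.2 ^ l, by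
    rw [div_pow, ← pow_mul, ← hkl, pow_mul, t.2.2, hK _ t.1.2, div_self']⟩, t.2, by
      simp [torusSlice, t.2.2]⟩
  left_inv s := Sigma.subtype_ext (Subtype.ext (mul_div_cancel_right _ _)) rfl
  right_inv t := Sigma.subtype_ext (Subtype.ext (Prod.ext t.2.2 (div_mul_cancel _ _))) rfl

theorem mul_ncard_mem_Icc (hn : n ≠ 0) (hk : k ≠ 0) (hkl : k * m = l * n)
    {K : Set (Circle × Circle)} (hK : ∀ y ∈ K, y.1 ^ m = y.2 ^ n) {lo hi : ℕ}
    (hlo : ∀ ζ, ζ ^ n = 1 → lo ≤ (torusSlice k l K ζ).encard)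
    (hhi : ∀ ζ, ζ ^ n = 1 → (torusSlice k l K ζ).encard ≤ hi) :
    k * K.ncard ∈ Set.Icc (n * lo) (n * hi) := by
  have hroots := natCard_circle_pow_eq hn 1
  have : Finite {ζ : Circle // ζ ^ n = 1} := Nat.finite_of_card_ne_zero (hroots.trans_ne hn)
  have hfiber (y : K) : {x : Circle // x ^ k = y.1.1} ≃ Fin k :=
    have hcard := natCard_circle_pow_eq hk y.1.1
    have := Nat.finite_of_card_ne_zero (hcard.trans_ne hk)
    Finite.equivFinOfCardEq hcard
  have hcount : Nat.card (Σ ζ : {ζ : Circle // ζ ^ n = 1}, torusSlice k l K ζ) = k * K.ncard := by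
    rw [Nat.card_congr ((sigmaTorusSliceEquiv hkl hK).trans
      ((Equiv.sigmaCongrRight hfiber).trans (Equiv.sigmaEquivProd K (Fin k)))), Nat.card_prod,
      Nat.card_coe_set_eq, Nat.card_fin, mul_comm]
  have hbounds := natCard_sigma_mem_Icc (S := fun ζ : {ζ : Circle // ζ ^ n = 1} =>
    torusSlice k l K ζ) (fun ζ => hlo ζ ζ.2) (fun ζ => hhi ζ ζ.2)
  rwa [hcount, hroots] at hbounds

end Covering

section CuspParameters

open Polynomial

variable {m n : ℕ} {a b A B : ℂ} {x₀ : ℂ × ℂ}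

/-- The points `(u, v)` of the torus for which `(u z₀, v w₀)` is a cusp, where `(z₀, w₀)` is a
critical point with unit normal `1`, `A = ā z₀ / m` and `B = b̄ w₀ / n`. -/
def cuspParams (m n : ℕ) (A B : ℂ) : Set (Circle × Circle) :=
  {y | ∃ α : Circle, y.1 ^ m = α ^ 2 ∧ y.2 ^ n = α ^ 2 ∧ (α * (A * y.1 + B * y.2)).re = 0}

theorem pow_eq_pow_of_mem_cuspParams {y : Circle × Circle} (hy : y ∈ cuspParams m n A B) :
    y.1 ^ m = y.2 ^ n :=
  let ⟨_, hu, hv, _⟩ := hy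
  hu.trans hv.symm

theorem torusSlice_cuspParams {ζ : Circle} (hζ : ζ ^ n = 1) :
    torusSlice (2 * n) (2 * m) (cuspParams m n A B) ζ =
      reZeros (C A * X ^ ((m + 2) * n) + C (B * ζ) * X ^ ((n + 2) * m)) := by
  ext x
  have hu : (x ^ (2 * n)) ^ m = (x ^ (m * n)) ^ 2 := by
    rw [← pow_mul, ← pow_mul]
    congr 1
    ring
  have hv : (ζ * x ^ (2 * m)) ^ n = (x ^ (m * n)) ^ 2 := by
    rw [mul_pow, hζ, one_mul, ← pow_mul, ← pow_mul]
    congr 1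
    ring
  have heval : (C A * X ^ ((m + 2) * n) + C (B * ζ) * X ^ ((n + 2) * m)).eval (x : ℂ) =
      (x ^ (m * n) : Circle) * (A * (x ^ (2 * n) : Circle) + B * (ζ * x ^ (2 * m) : Circle)) := by
    simp
    ring
  simp only [torusSlice, cuspParams, reZeros, Set.mem_ofPred_eq, hu, hv, heval]
  constructor
  · rintro ⟨α, hα, -, hre⟩
    have hsign : (α : ℂ) = (x ^ (m * n) : Circle) ∨ (α : ℂ) = -(x ^ (m * n) : Circle) :=
      sq_eq_sq_iff_eq_or_eq_neg.1 (congrArg ((↑) : Circle → ℂ) hα.symm)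
    rcases hsign with h | h
    · rwa [h] at hre
    · rwa [h, neg_mul, Complex.neg_re, neg_eq_zero] at hre
  · exact fun hre => ⟨x ^ (m * n), rfl, rfl, hre⟩

theorem ncard_cuspParams_mem_Icc (hm : m ≠ 0) (hn : n ≠ 0) (hnm : n ≤ m)
    (hproper : ∀ ζ, ζ ^ n = 1 →
      torusSlice (2 * n) (2 * m) (cuspParams m n A B) ζ ≠ Set.univ) :
    (cuspParams m n A B).ncard ∈ Set.Icc ((m + 2) * n) ((n + 2) * m) := by
  have hdeg : (m + 2) * n ≤ (n + 2) * m := by linarith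
  have hlo (ζ : Circle) (hζ : ζ ^ n = 1) : (2 * ((m + 2) * n) : ℕ) ≤
      (torusSlice (2 * n) (2 * m) (cuspParams m n A B) ζ).encard := by
    rw [torusSlice_cuspParams hζ]
    exact two_mul_le_encard_reZeros (by positivity) hdeg
  have hhi (ζ : Circle) (hζ : ζ ^ n = 1) :
      (torusSlice (2 * n) (2 * m) (cuspParams m n A B) ζ).encard ≤ (2 * ((n + 2) * m) : ℕ) := by
    have hne := hproper ζ hζ
    rw [torusSlice_cuspParams hζ] at hne ⊢
    refine (encard_reZeros_le hne).trans ?_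
    gcongr
    compute_degree
    exact max_le hdeg le_rfl
  obtain ⟨h1, h2⟩ := mul_ncard_mem_Icc hn (mul_ne_zero two_ne_zero hn) (by ring)
    (fun _ => pow_eq_pow_of_mem_cuspParams) hlo hhi
  have hn_pos : 0 < 2 * n := by positivity
  exact ⟨le_of_mul_le_mul_left (by linarith) hn_pos, le_of_mul_le_mul_left (by linarith) hn_pos⟩

/-- The orbit map of a point of `ℂ²` under the componentwise action of the torus. -/
def torusOrbit (x₀ : ℂ × ℂ) (y : Circle × Circle) : ℂ × ℂ := (x₀.1 * y.1, x₀.2 * y.2)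

theorem continuous_torusOrbit (x₀ : ℂ × ℂ) : Continuous (torusOrbit x₀) := by
  unfold torusOrbit
  fun_prop

theorem injOn_torusOrbit (hz₀ : x₀.1 ≠ 0 ∨ m = 1) (hw₀ : x₀.2 ≠ 0 ∨ n = 1)
    (hx₀ : x₀.1 ≠ 0 ∨ x₀.2 ≠ 0) : Set.InjOn (torusOrbit x₀) {y | y.1 ^ m = y.2 ^ n} := by
  rintro ⟨u, v⟩ (huv : u ^ m = v ^ n) ⟨u', v'⟩ (huv' : u' ^ m = v' ^ n) heq
  obtain ⟨hu, hv⟩ := Prod.mk.inj heq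
  simp only [mul_eq_mul_left_iff, Circle.coe_inj] at hu hv
  rcases hu with rfl | hu
  · rcases hv with rfl | hv
    · rfl
    · obtain rfl := hw₀.resolve_left (not_not.2 hv)
      rw [← pow_one v, ← pow_one v', ← huv, ← huv']
  · obtain rfl := hz₀.resolve_left (not_not.2 hu)
    obtain rfl := hv.resolve_right (hx₀.resolve_left (not_not.2 hu))
    rw [← pow_one u, ← pow_one u', huv, huv']

theorem setOf_isDegenerateCritical_eq_image (h₀ : IsUnitConormal m n a b 1 x₀) (hm : m ≠ 0)
    (hn : n ≠ 0) (ha : a ≠ 0 ∨ m = 1) (hb : b ≠ 0 ∨ n = 1) (hab : a ≠ 0 ∨ b ≠ 0) :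
    {x | IsDegenerateCritical (deformedBrieskorn (m + 1) (n + 1) a b) x} =
      torusOrbit x₀ '' cuspParams m n (conj a * x₀.1 / m) (conj b * x₀.2 / n) := by
  have hz₀ : x₀.1 ≠ 0 ∨ m = 1 := ha.imp_left (mt (h₀.fst_eq_zero_iff hm).1)
  have hw₀ : x₀.2 ≠ 0 ∨ n = 1 := hb.imp_left (mt (h₀.snd_eq_zero_iff hn).1)
  have hrescale (y : Circle × Circle) :
      conj a * (torusOrbit x₀ y).1 / m + conj b * (torusOrbit x₀ y).2 / n =
        conj a * x₀.1 / m * y.1 + conj b * x₀.2 / n * y.2 := by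
    simp only [torusOrbit]
    ring
  ext x
  simp only [Set.mem_ofPred_eq, isDegenerateCritical_iff_exists_re_eq_zero hm hn ha hb hab,
    h₀.iff_exists_circle hm hn hz₀ hw₀]
  constructor
  · rintro ⟨α, ⟨y, hu, hv, rfl⟩, hre⟩
    exact ⟨y, ⟨α, hu, hv, hrescale y ▸ hre⟩, rfl⟩
  · rintro ⟨y, ⟨α, hu, hv, hre⟩, rfl⟩
    exact ⟨α, ⟨y, hu, hv, rfl⟩, (hrescale y).symm ▸ hre⟩

theorem IsExcellentMap.torusSlice_ne_univ {E F : Type*} [NormedAddCommGroup E] [NormedSpace ℝ E]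
    [NormedAddCommGroup F] [NormedSpace ℝ F] {f : E → F} (hf : IsExcellentMap f)
    {Φ : Circle × Circle → E} (hΦ : Continuous Φ) {K : Set (Circle × Circle)}
    (hinj : Set.InjOn Φ K) (hdeg : ∀ y ∈ K, IsDegenerateCritical f (Φ y)) {k : ℕ} (hk : k ≠ 0)
    (l : ℕ) (ζ : Circle) : torusSlice k l K ζ ≠ Set.univ := by
  intro huniv
  have hmem (x : Circle) : (x ^ k, ζ * x ^ l) ∈ K := huniv.ge (Set.mem_univ x)
  obtain ⟨x, hx⟩ := exists_circle_pow_eq hk (-1)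
  have hconst : Φ (x ^ k, ζ * x ^ l) = Φ (1 ^ k, ζ * 1 ^ l) :=
    hf.apply_eq_apply_of_continuous (γ := fun x : Circle => Φ (x ^ k, ζ * x ^ l))
      (by fun_prop) (fun x => hdeg _ (hmem x)) x 1
  have hpow : x ^ k = 1 := by simpa using congrArg Prod.fst (hinj (hmem x) (hmem 1) hconst)
  have : (1 : ℂ) = -1 := congrArg ((↑) : Circle → ℂ) (hpow.symm.trans hx)
  norm_num at this

theorem IsExcellentMap.ncard_cuspSet_mem_Icc (hm : m ≠ 0) (hn : n ≠ 0) (hnm : n ≤ m)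
    (hf : IsExcellentMap (deformedBrieskorn (m + 1) (n + 1) a b)) :
    (cuspSet (deformedBrieskorn (m + 1) (n + 1) a b)).ncard ∈
      Set.Icc ((m + 2) * n) ((n + 2) * m) := by
  have ha := hf.ne_zero_or_eq_one_left hm hn
  have hb := hf.ne_zero_or_eq_one_right hm hn
  have hab := hf.ne_zero_or_ne_zero hm hn
  obtain ⟨x₀, h₀⟩ := exists_isUnitConormal_one hm hn a b
  have hz₀ := mt (h₀.fst_eq_zero_iff hm).1
  have hw₀ := mt (h₀.snd_eq_zero_iff hn).1
  have hinj := (injOn_torusOrbit (ha.imp_left hz₀) (hb.imp_left hw₀) (hab.imp hz₀ hw₀)).mono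
    fun _ => pow_eq_pow_of_mem_cuspParams (A := conj a * x₀.1 / m) (B := conj b * x₀.2 / n)
  have himage := setOf_isDegenerateCritical_eq_image h₀ hm hn ha hb hab
  have hcusp : cuspSet (deformedBrieskorn (m + 1) (n + 1) a b) =
      {x | IsDegenerateCritical (deformedBrieskorn (m + 1) (n + 1) a b) x} :=
    Set.ext fun x => hf.isCuspPoint_iff
  rw [hcusp, himage, hinj.ncard_image]
  exact ncard_cuspParams_mem_Icc hm hn hnm fun ζ _ => hf.torusSlice_ne_univ
    (continuous_torusOrbit x₀) hinj (fun y hy => himage.ge ⟨y, hy, rfl⟩)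
    (mul_ne_zero two_ne_zero hn) (2 * m) ζ

end CuspParameters

theorem theorem1p2 (p q : ℕ) (hq : 2 ≤ q) (hpq : q ≤ p) (a b : ℂ)
    (hf : IsExcellentMap (deformedBrieskorn p q a b)) :
    (cuspSet (deformedBrieskorn p q a b)).Finite ∧
    ((cuspSet (deformedBrieskorn p q a b)).ncard : ℤ) ∈
      Set.Icc (((p : ℤ) + 1) * ((q : ℤ) - 1)) (((p : ℤ) - 1) * ((q : ℤ) + 1)) ∧
    (p = q → ((cuspSet (deformedBrieskorn p q a b)).ncard : ℤ) = (p : ℤ) ^ 2 - 1) := by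
  obtain ⟨m, rfl⟩ : ∃ m, p = m + 1 := ⟨p - 1, by omega⟩
  obtain ⟨n, rfl⟩ : ∃ n, q = n + 1 := ⟨q - 1, by omega⟩
  have hn : 0 < n := by omega
  obtain ⟨hlower, hupper⟩ := hf.ncard_cuspSet_mem_Icc (by omega) hn.ne' (by omega)
  have hpos : 0 < (cuspSet (deformedBrieskorn (m + 1) (n + 1) a b)).ncard :=
    lt_of_lt_of_le (by positivity) hlower
  zify at hlower hupper
  push_cast
  refine ⟨Set.finite_of_ncard_pos hpos, ⟨by linarith, by linarith⟩, fun hpq => ?_⟩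
  obtain rfl : m = n := by omega
  linarith
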